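/- Let $V$ be a finite set of nodes, $E\subseteq V\times V$ a set of directed edges, and $\ell:V\to\Phi$ a map that assigns to each node a color. Let $P=(P_{ij})_{i,j\in V}$ be a row-stochastic matrix with $P_{ij}>0$ if and only if $(i,j)\in E$. Let $X_1,X_2,\dots$ be a time-homogeneous Markov chain on $V$ with transition matrix $P$ and any initial distribution for which every recurrent class (defined below) is visited with positive probability, and let $Y_t=\ell(X_t)$ be the lumped process. A node $j$ is accessible from $i$ if there is a directed path (possibly of length $0$) from $i$ to $j$. A node $i$ is recurrent if $i$ is accessible from every node that is accessible from $i$, and a recurrent class is the set of all nodes accessible from some recurrent node. A node is aperiodic if the greatest common divisor of the lengths of the closed walks of positive length from it to itself is $1$. A recurrent class $C$ is trackable if there is $k\ge 0$ with $n_C(t)=O(t^k)$ as $t\to\infty$, where $n_C(t)$ is the maximum, over all color sequences $(y_1,\dots,y_t)\in\Phi^t$, of the number of sequences $(x_1,\dots,x_t)\in C^t$ with $\ell(x_s)=y_s$ for $1\le s\le t$ and $(x_s,x_{s+1})\in E$ for $1\le s<t$. Suppose that all recurrent nodes are aperiodic. Then the conditional entropy rate $$H(X|Y)=\lim_{T\to\infty}\frac1T\,H(X_1,\dots,X_T\mid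 Y_1,\dots,Y_T)$$ exists, where $H(\cdot\mid\cdot)$ is the Shannon conditional entropy in bits, and $H(X|Y)=0$ if and only if every recurrent class is trackable. -/

import Mathlib

open Filter Topology MeasureTheory Asymptotics

/-- A single-colored weak model: a directed graph on `V` (loops allowed) whose nodes carry colors
in `Φ`. -/
structure WeakModel (V Φ : Type*) where
  /-- `Adj i j` says that `(i, j)` is an edge. -/
  Adj : V → V → Prop
  /-- The color emitted by a node. -/
  color : V → Φ

namespace WeakModel

/-- The submodel on a set of nodes, with all the edges between these nodes. -/
def induce {V Φ : Type*} (G : WeakModel V Φ) (C : Set V) : WeakModel C Φ where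
  Adj i j := G.Adj i j
  color i := G.color i

/-- The node sequences of length `t` that follow edges and emit the color sequence `y`. -/
def hypotheses {V Φ : Type*} (G : WeakModel V Φ) {t : ℕ} (y : Fin t → Φ) : Set (Fin t → V) :=
  {x | (∀ i, G.color (x i) = y i) ∧ ∀ i j : Fin t, (j : ℕ) = (i : ℕ) + 1 → G.Adj (x i) (x j)}

/-- The worst-case number of hypotheses for a color sequence of length `t`. With finitely many
nodes these numbers are bounded by `|V| ^ t`, so that the supremum is a maximum. -/
noncomputable def maxHypotheses {V Φ : Type*} (G : WeakModel V Φ) (t : ℕ) : ℕ :=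
  ⨆ y : Fin t → Φ, (G.hypotheses y).ncard

/-- The worst-case number of hypotheses grows at most polynomially. -/
def Trackable {V Φ : Type*} (G : WeakModel V Φ) : Prop :=
  ∃ k : ℕ, (fun t : ℕ => (G.maxHypotheses t : ℝ)) =O[atTop] fun t : ℕ => (t : ℝ) ^ k

/-- `j` can be reached from `i` along edges. -/
def Accessible {V Φ : Type*} (G : WeakModel V Φ) (i j : V) : Prop :=
  Relation.ReflTransGen G.Adj i j

/-- `i` is accessible from every node that is accessible from `i`. -/
def Recurrent {V Φ : Type*} (G : WeakModel V Φ) (i : V) : Prop :=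
  ∀ j, G.Accessible i j → G.Accessible j i

/-- The set of nodes accessible from some recurrent node. -/
def IsRecurrentClass {V Φ : Type*} (G : WeakModel V Φ) (C : Set V) : Prop :=
  ∃ i, G.Recurrent i ∧ C = {j | G.Accessible i j}

/-- There is a closed walk with `n` edges from `i` to `i`. -/
def HasClosedWalk {V Φ : Type*} (G : WeakModel V Φ) (i : V) (n : ℕ) : Prop :=
  ∃ x : ℕ → V, x 0 = i ∧ x n = i ∧ ∀ k < n, G.Adj (x k) (x (k + 1))

/-- The greatest common divisor of the lengths of the closed walks through `i` is `1`. -/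
def Aperiodic {V Φ : Type*} (G : WeakModel V Φ) (i : V) : Prop :=
  ∀ d : ℕ, (∀ n, 0 < n → G.HasClosedWalk i n → d ∣ n) → d = 1

end WeakModel

/-- `X 0, X 1, X 2, …` is a time-homogeneous Markov chain with transition probabilities `P`
(and any initial distribution). -/
structure IsMarkovChain {Ω V : Type*} [MeasurableSpace Ω] [MeasurableSpace V]
    (μ : Measure Ω) (P : Matrix V V ℝ) (X : ℕ → Ω → V) : Prop where
  measurable : ∀ t, Measurable (X t)
  law : ∀ (T : ℕ) (x : ℕ → V),
    μ.real {ω | ∀ t ≤ T, X t ω = x t} =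
      μ.real {ω | X 0 ω = x 0} * ∏ t ∈ Finset.range T, P (x t) (x (t + 1))

/-- The Shannon conditional entropy `H(A | B)` in bits of random variables that take finitely many
values: `- ∑ b, p(b) ∑ a, p(a | b) log₂ p(a | b)`. -/
noncomputable def condEntropy {Ω α β : Type*} [MeasurableSpace Ω] [Fintype α]
    (μ : Measure Ω) (A : Ω → α) (B : Ω → β) : ℝ :=
  -∑ᶠ b : β, μ.real {ω | B ω = b} *
    ∑ a : α, (μ.real {ω | A ω = a ∧ B ω = b} / μ.real {ω | B ω = b}) *
      Real.logb 2 (μ.real {ω | A ω = a ∧ B ω = b} / μ.real {ω | B ω = b})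

/-! ### Entropy of a finite weighted set given a function on it. -/

section FiberEntropy

/-! Let e_n(i) be the entropy of an n-step path from i, given its colors and its last node
(`bridgeEntropy`). By the Markov property, revealing the node at time T cuts a path into two
conditionally independent pieces of the same kind, and this extra information is worth between 0 and
log₂ |V| bits. Hence e_T + P^T e_S ≤ e_{T+S} ≤ e_T + P^T e_S + log₂ |V| (`bridgeEntropy_add`). The
conditional entropy of the chain differs from the mean of e_n over the initial law π by at most log₂
|V × V| (`IsMarkovChain.condEntropy_bounds`), so the entropy rate exists once e_n / n converges.

Let Q be a limit point of the Cesàro averages of the powers of P. Since Q P = Q, the factor P^T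
disappears under Q: the sequence Q e_n is superadditive, and subadditive up to a constant. So Q e_n
/ n converges to some L and never exceeds it. Replacing e_n by P^T e_n costs only a bounded amount,
so e_n / n has the same limit and P L = L (`exists_harmonic_rate`).

The entropy rate is ∑ π_i L_i. If it vanishes, harmonicity carries L = 0 from the possible initial
nodes into every recurrent class C. On C this gives Q e_n ≤ n L = 0; a row of Q charges all of C, so
e_n = 0 on C for every n. Thus a path in C is determined by its colors and its two endpoints, which
leaves at most |V|² hypotheses. Conversely, polynomially many hypotheses give e_n = O(log n), hence
L = 0, at recurrent nodes, and the maximum principle extends this to all nodes. -/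

open scoped Classical in
/-- The total weight of the fiber of `g` through `a`. -/
noncomputable def fiberMass {α β : Type*} [Fintype α] (p : α → ℝ) (g : α → β) (a : α) : ℝ :=
  ∑ a' with g a' = g a, p a'

/-- The conditional entropy, in bits, of the identity given `g` under the weights `p`. -/
noncomputable def fiberEntropy {α β : Type*} [Fintype α] (p : α → ℝ) (g : α → β) : ℝ :=
  ∑ a, p a * Real.logb 2 (fiberMass p g a / p a)

variable {α β γ : Type*} [Fintype α] {p : α → ℝ} {g : α → β} {g' : α → γ}

lemma le_fiberMass (hp : ∀ a, 0 ≤ p a) (g : α → β) (a : α) : p a ≤ fiberMass p g a := by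
  classical
  exact Finset.single_le_sum (f := p) (fun a' _ => hp a') (by simp)

lemma fiberMass_mono (hp : ∀ a, 0 ≤ p a) (h : ∀ a a', g' a' = g' a → g a' = g a) (a : α) :
    fiberMass p g' a ≤ fiberMass p g a := by
  classical
  refine Finset.sum_le_sum_of_subset_of_nonneg ?_ fun a' _ _ => hp a'
  intro a' ha'
  simp only [Finset.mem_filter, Finset.mem_univ, true_and] at ha' ⊢
  exact h _ _ ha'

lemma mul_logb_fiberMass_div_nonneg (hp : ∀ a, 0 ≤ p a) (g : α → β) (a : α) :
    0 ≤ p a * Real.logb 2 (fiberMass p g a / p a) := by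
  rcases (hp a).eq_or_lt with h | h
  · simp [← h]
  · refine mul_nonneg h.le (Real.logb_nonneg one_lt_two ?_)
    rw [one_le_div h]
    exact le_fiberMass hp g a

lemma fiberEntropy_nonneg (hp : ∀ a, 0 ≤ p a) (g : α → β) : 0 ≤ fiberEntropy p g :=
  Finset.sum_nonneg fun a _ => mul_logb_fiberMass_div_nonneg hp g a

/-- Conditioning on more can only lower the entropy. -/
lemma fiberEntropy_anti (hp : ∀ a, 0 ≤ p a) (h : ∀ a a', g' a' = g' a → g a' = g a) :
    fiberEntropy p g' ≤ fiberEntropy p g := by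
  refine Finset.sum_le_sum fun a _ => ?_
  rcases (hp a).eq_or_lt with h0 | h0
  · simp [← h0]
  · refine mul_le_mul_of_nonneg_left ?_ h0.le
    have h1 := le_fiberMass hp g' a
    have h2 := fiberMass_mono hp h a
    exact Real.logb_le_logb_of_le one_lt_two (div_pos (h0.trans_le h1) h0) (by gcongr)

lemma fiberEntropy_congr (h : ∀ a a', g' a' = g' a ↔ g a' = g a) :
    fiberEntropy p g' = fiberEntropy p g := by
  classical
  simp only [fiberEntropy, fiberMass, h]

lemma fiberMass_id (p : α → ℝ) (a : α) : fiberMass p (fun a => a) a = p a := by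
  classical
  rw [fiberMass, Finset.sum_filter, Finset.sum_eq_single a] <;> simp +contextual

lemma fiberEntropy_id (p : α → ℝ) : fiberEntropy p (fun a => a) = 0 := by
  refine Finset.sum_eq_zero fun a _ => ?_
  rw [fiberMass_id]
  by_cases h : p a = 0 <;> simp [h]

/-- Two distinct points of positive weight in one fiber force the entropy to be positive. -/
lemma fiberEntropy_pos (hp : ∀ a, 0 ≤ p a) {a b : α} (hab : a ≠ b) (hg : g a = g b)
    (ha : 0 < p a) (hb : 0 < p b) : 0 < fiberEntropy p g := by
  classical
  refine Finset.sum_pos' (fun a _ => mul_logb_fiberMass_div_nonneg hp g a)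
    ⟨a, Finset.mem_univ a, mul_pos ha (Real.logb_pos one_lt_two ?_)⟩
  rw [one_lt_div ha]
  calc p a < p a + p b := by linarith
    _ = ∑ a' ∈ {a, b}, p a' := (Finset.sum_pair hab).symm
    _ ≤ fiberMass p g a := by
      refine Finset.sum_le_sum_of_subset_of_nonneg ?_ fun a' _ _ => hp a'
      intro c hc
      simp only [Finset.mem_insert, Finset.mem_singleton] at hc
      rcases hc with rfl | rfl <;> simp [hg]

-- Gibbs' inequality: log x ≤ x - 1 is applied to x = W / (N W'), with W and W' the masses of the
-- fibers of `g` and `g'`. The error terms then sum to at most zero by the bound on the sums of p /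
-- W'. Both upper bounds on entropy below are instances.
open scoped Classical in
lemma fiberEntropy_le_add_logb (hp : ∀ a, 0 ≤ p a) (hp1 : ∑ a, p a = 1) {N : ℝ} (hN : 0 < N)
    (h : ∀ a', ∑ a with g a = g a', p a / fiberMass p g' a ≤ N) :
    fiberEntropy p g ≤ fiberEntropy p g' + Real.logb 2 N := by
  have hlog2 : 0 < Real.log 2 := Real.log_pos one_lt_two
  have key : ∀ a, p a * Real.logb 2 (fiberMass p g a / p a) ≤
      p a * Real.logb 2 (fiberMass p g' a / p a) + p a * Real.logb 2 N +
        (N⁻¹ * (p a / fiberMass p g' a * fiberMass p g a) - p a) / Real.log 2 := by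
    intro a
    rcases (hp a).eq_or_lt with h0 | h0
    · simp [← h0]
    have hW : 0 < fiberMass p g a := h0.trans_le (le_fiberMass hp g a)
    have hW' : 0 < fiberMass p g' a := h0.trans_le (le_fiberMass hp g' a)
    have h1 : Real.log (fiberMass p g a / (N * fiberMass p g' a)) ≤
        fiberMass p g a / (N * fiberMass p g' a) - 1 :=
      Real.log_le_sub_one_of_pos (by positivity)
    rw [Real.log_div hW.ne' (by positivity), Real.log_mul hN.ne' hW'.ne'] at h1
    simp only [Real.logb, Real.log_div hW.ne' h0.ne', Real.log_div hW'.ne' h0.ne']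
    have h2 := mul_le_mul_of_nonneg_left h1 h0.le
    have h3 : N⁻¹ * (p a / fiberMass p g' a * fiberMass p g a) - p a =
        p a * (fiberMass p g a / (N * fiberMass p g' a) - 1) := by field_simp
    rw [h3]
    have h4 := div_le_div_of_nonneg_right h2 hlog2.le
    have h5 : p a * ((Real.log (fiberMass p g a) - Real.log (p a)) / Real.log 2) =
      p a * ((Real.log (fiberMass p g' a) - Real.log (p a)) / Real.log 2) +
        p a * (Real.log N / Real.log 2) +
        p a * (Real.log (fiberMass p g a) - (Real.log N + Real.log (fiberMass p g' a)))
          / Real.log 2 := by ring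
    rw [h5]
    gcongr
  have hsum : ∑ a, p a / fiberMass p g' a * fiberMass p g a ≤ N := by
    calc ∑ a, p a / fiberMass p g' a * fiberMass p g a
        = ∑ a, ∑ a', if g a' = g a then p a / fiberMass p g' a * p a' else 0 := by
          refine Finset.sum_congr rfl fun a _ => ?_
          rw [← Finset.sum_filter, ← Finset.mul_sum]
          rfl
      _ = ∑ a', p a' * ∑ a with g a = g a', p a / fiberMass p g' a := by
          rw [Finset.sum_comm]
          refine Finset.sum_congr rfl fun a' _ => ?_
          rw [Finset.mul_sum, Finset.sum_filter]
          refine Finset.sum_congr rfl fun a _ => ?_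
          simp only [eq_comm (a := g a'), mul_comm]
      _ ≤ ∑ a', p a' * N := Finset.sum_le_sum fun a' _ => mul_le_mul_of_nonneg_left (h a') (hp a')
      _ = N := by rw [← Finset.sum_mul, hp1, one_mul]
  have hle : (∑ a, (N⁻¹ * (p a / fiberMass p g' a * fiberMass p g a) - p a)) / Real.log 2 ≤ 0 := by
    refine div_nonpos_of_nonpos_of_nonneg ?_ hlog2.le
    rw [Finset.sum_sub_distrib, ← Finset.mul_sum, hp1, sub_nonpos, inv_mul_le_iff₀ hN, mul_one]
    exact hsum
  calc fiberEntropy p g ≤ _ := Finset.sum_le_sum fun a _ => key a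
    _ = fiberEntropy p g' + Real.logb 2 N +
        (∑ a, (N⁻¹ * (p a / fiberMass p g' a * fiberMass p g a) - p a)) / Real.log 2 := by
      rw [Finset.sum_add_distrib, Finset.sum_add_distrib, ← Finset.sum_mul, hp1, one_mul,
        Finset.sum_div, fiberEntropy]
    _ ≤ _ := by linarith

/-- Conditioning on one more variable with values in `K` lowers the entropy by at most
`log₂ |K|`. -/
lemma fiberEntropy_le_add_logb_card {K : Type*} [Fintype K] (hp : ∀ a, 0 ≤ p a)
    (hp1 : ∑ a, p a = 1) (k : α → K) (h : ∀ a a', g a' = g a → k a' = k a → g' a' = g' a) :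
    fiberEntropy p g ≤ fiberEntropy p g' + Real.logb 2 (Fintype.card K) := by
  classical
  have : Nonempty α := by
    by_contra hα
    rw [not_nonempty_iff] at hα
    simp at hp1
  have : Nonempty K := ⟨k (Classical.arbitrary α)⟩
  refine fiberEntropy_le_add_logb hp hp1 (by exact_mod_cast Fintype.card_pos) fun b => ?_
  -- For each value c of `k`, the points of the `g`-fiber with `k a = c` lie in a single `g'`-fiber,
  -- so their share of its mass is at most 1. Summing over c gives |K|.
  rw [← Finset.sum_fiberwise (s := Finset.univ.filter fun a => g a = g b) (g := k)]
  have : ∀ c : K, ∑ a ∈ (Finset.univ.filter fun a => g a = g b) with k a = c,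
      p a / fiberMass p g' a ≤ 1 := by
    intro c
    set S := (Finset.univ.filter fun a => g a = g b).filter fun a => k a = c with hS
    have hle : ∀ a ∈ S, ∑ a' ∈ S, p a' ≤ fiberMass p g' a := by
      intro a ha
      refine Finset.sum_le_sum_of_subset_of_nonneg ?_ fun a' _ _ => hp a'
      intro a' ha'
      simp only [hS, Finset.mem_filter, Finset.mem_univ, true_and] at ha ha' ⊢
      exact h _ _ (ha'.1.trans ha.1.symm) (ha'.2.trans ha.2.symm)
    rcases (Finset.sum_nonneg fun a (_ : a ∈ S) => hp a).eq_or_lt with h0 | h0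
    · have h1 := (Finset.sum_eq_zero_iff_of_nonneg fun a (_ : a ∈ S) => hp a).1 h0.symm
      rw [Finset.sum_eq_zero fun a ha => by rw [h1 a ha, zero_div]]
      exact zero_le_one
    · calc ∑ a ∈ S, p a / fiberMass p g' a ≤ ∑ a ∈ S, p a / ∑ a' ∈ S, p a' :=
          Finset.sum_le_sum fun a ha => div_le_div_of_nonneg_left (hp a) h0 (hle a ha)
        _ = 1 := by rw [← Finset.sum_div, div_self h0.ne']
  calc _ ≤ ∑ _c : K, (1 : ℝ) := Finset.sum_le_sum fun c _ => this c
    _ = Fintype.card K := by simp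

open scoped Classical in
/-- The entropy is at most `log₂ N` if every fiber has at most `N` points of positive weight. -/
lemma fiberEntropy_le_logb (hp : ∀ a, 0 ≤ p a) (hp1 : ∑ a, p a = 1) {N : ℝ} (hN : 0 < N)
    (h : ∀ a', 0 < p a' → ((Finset.univ.filter fun a => g a = g a' ∧ 0 < p a).card : ℝ) ≤ N) :
    fiberEntropy p g ≤ Real.logb 2 N := by
  -- For `g'` the identity the ratio p a / p a is 1 on the support and 0 / 0 = 0 off it, so the sum
  -- counts the points of positive weight.
  have := fiberEntropy_le_add_logb (g := g) (g' := fun a : α => a) hp hp1 hN fun b => by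
    simp only [fiberMass_id]
    have h1 : ∀ a, p a / p a = if 0 < p a then 1 else 0 := fun a => by
      split_ifs with h0
      · exact div_self h0.ne'
      · rw [le_antisymm (not_lt.1 h0) (hp a), zero_div]
    simp only [h1]
    rw [← Finset.sum_filter, Finset.filter_filter, Finset.sum_const, nsmul_eq_mul, mul_one]
    by_cases hb : ∃ b', g b' = g b ∧ 0 < p b'
    · obtain ⟨b', hb', hpos⟩ := hb
      rw [← hb']
      exact h b' hpos
    · rw [Finset.filter_false_of_mem]
      · simpa using hN.le
      · intro a _ ha
        exact hb ⟨a, ha⟩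
  rwa [fiberEntropy_id, zero_add] at this

lemma fiberEntropy_comp_equiv {α' : Type*} [Fintype α'] (e : α' ≃ α) (p : α → ℝ) (g : α → β) :
    fiberEntropy (p ∘ e) (g ∘ e) = fiberEntropy p g := by
  classical
  have hm : ∀ a, fiberMass (p ∘ e) (g ∘ e) a = fiberMass p g (e a) := fun a => by
    simp only [fiberMass, Finset.sum_filter, Function.comp_apply]
    exact e.sum_comp fun a' => if g a' = g (e a) then p a' else 0
  simp only [fiberEntropy, hm, Function.comp_apply]
  exact e.sum_comp fun a => p a * Real.logb 2 (fiberMass p g a / p a)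

/-- Chain rule: if the second component depends on the first one only through `k`, then, given `k`,
the entropies of the two components add up. -/
lemma fiberEntropy_prod {A B K γ : Type*} [Fintype A] [Fintype B] {q : A → ℝ} {r : K → B → ℝ}
    (hq : ∀ a, 0 ≤ q a) (hr : ∀ k b, 0 ≤ r k b) (hr1 : ∀ k, ∑ b, r k b = 1) (k : A → K)
    (g₁ : A → β) (g₂ : K → B → γ) :
    fiberEntropy (fun x : A × B => q x.1 * r (k x.1) x.2)
        (fun x => ((g₁ x.1, k x.1), g₂ (k x.1) x.2)) =
      fiberEntropy q (fun a => (g₁ a, k a)) + ∑ a, q a * fiberEntropy (r (k a)) (g₂ (k a)) := by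
  classical
  have hm : ∀ a b, fiberMass (fun x : A × B => q x.1 * r (k x.1) x.2)
      (fun x => ((g₁ x.1, k x.1), g₂ (k x.1) x.2)) (a, b) =
      fiberMass q (fun a => (g₁ a, k a)) a * fiberMass (r (k a)) (g₂ (k a)) b := by
    intro a b
    simp only [fiberMass, Finset.sum_filter, Fintype.sum_prod_type]
    rw [Finset.sum_mul_sum]
    refine Finset.sum_congr rfl fun a' _ => Finset.sum_congr rfl fun b' _ => ?_
    by_cases h1 : g₁ a' = g₁ a <;> by_cases h2 : k a' = k a <;> simp [h1, h2]
  simp only [fiberEntropy, Fintype.sum_prod_type, hm, ← Finset.sum_add_distrib]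
  refine Finset.sum_congr rfl fun a _ => ?_
  -- The factor 1 = ∑ b, r (k a) b spreads the first entropy over `B`, so that the identity can be
  -- checked pointwise.
  rw [← mul_one (q a * Real.logb 2 _), ← hr1 (k a), Finset.mul_sum, Finset.mul_sum,
    ← Finset.sum_add_distrib]
  refine Finset.sum_congr rfl fun b _ => ?_
  rcases (hq a).eq_or_lt with h0 | h0
  · simp [← h0]
  rcases (hr (k a) b).eq_or_lt with h1 | h1
  · simp [← h1]
  have hW := h0.trans_le (le_fiberMass hq (fun a => (g₁ a, k a)) a)
  have hW' := h1.trans_le (le_fiberMass (hr (k a)) (g₂ (k a)) b)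
  rw [mul_div_mul_comm, Real.logb_mul (div_pos hW h0).ne' (div_pos hW' h1).ne']
  ring

end FiberEntropy

/-! ### Conditional entropy as fiber entropy. -/

/-- The conditional entropy of a random variable given a function of it. -/
lemma condEntropy_comp_eq_fiberEntropy {Ω α β : Type*} [MeasurableSpace Ω] [Fintype α]
    (μ : Measure Ω) [IsFiniteMeasure μ] (A : Ω → α) (hA : ∀ a, MeasurableSet {ω | A ω = a})
    (g : α → β) :
    condEntropy μ A (fun ω => g (A ω)) = fiberEntropy (fun a => μ.real {ω | A ω = a}) g := by
  classical
  set p : α → ℝ := fun a => μ.real {ω | A ω = a} with hp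
  have hjoint : ∀ a b, μ.real {ω | A ω = a ∧ g (A ω) = b} = if g a = b then p a else 0 := by
    intro a b
    split_ifs with h
    · rw [hp]
      congr 1
      ext ω
      simp only [Set.mem_ofPred_eq]
      exact ⟨And.left, fun h' => ⟨h', by rw [h', h]⟩⟩
    · have : {ω | A ω = a ∧ g (A ω) = b} = ∅ := by
        ext ω
        simp only [Set.mem_ofPred_eq, Set.mem_empty_iff_false, iff_false, not_and]
        rintro rfl
        exact h
      rw [this, measureReal_empty]
  have hmass : ∀ b, μ.real {ω | g (A ω) = b} = ∑ a with g a = b, p a := by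
    intro b
    have : {ω | g (A ω) = b} = ⋃ a ∈ Finset.univ.filter (fun a => g a = b), {ω | A ω = a} := by
      ext ω
      simp
    rw [this, measureReal_biUnion_finset]
    · intro a _ a' _ hne
      refine Set.disjoint_left.2 fun ω h h' => hne ?_
      exact h.symm.trans h'
    · exact fun a _ => hA a
  have hfin : condEntropy μ A (fun ω => g (A ω)) =
      -∑ b ∈ Finset.univ.image g, (∑ a with g a = b, p a) *
        ∑ a, ((if g a = b then p a else 0) / ∑ a with g a = b, p a) *
          Real.logb 2 ((if g a = b then p a else 0) / ∑ a with g a = b, p a) := by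
    rw [condEntropy]
    simp only [hjoint, hmass]
    -- `β` may be infinite, but only values of `g` contribute.
    rw [finsum_eq_sum_of_support_subset]
    intro b hb
    by_contra hb'
    refine hb ?_
    have : Finset.univ.filter (fun a => g a = b) = ∅ := by
      refine Finset.filter_false_of_mem fun a _ h => hb' ?_
      simpa using ⟨a, h⟩
    simp [this]
  rw [hfin, ← Finset.sum_neg_distrib, fiberEntropy,
    ← Finset.sum_fiberwise_of_maps_to (s := Finset.univ) (t := Finset.univ.image g) (g := g)
      (fun a _ => Finset.mem_image_of_mem g (Finset.mem_univ a))]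
  refine Finset.sum_congr rfl fun b _ => ?_
  rw [Finset.mul_sum, ← Finset.sum_neg_distrib, Finset.sum_filter (fun a => g a = b)
    fun a => p a * Real.logb 2 (fiberMass p g a / p a)]
  refine Finset.sum_congr rfl fun a _ => ?_
  split_ifs with h
  · rw [fiberMass, h]
    set W := ∑ a with g a = b, p a with hW
    have hpa : 0 ≤ p a := measureReal_nonneg
    rcases hpa.eq_or_lt with h0 | h0
    · rw [← h0]
      simp
    have hpos : 0 < W := h0.trans_le <|
      Finset.single_le_sum (f := p) (fun _ _ => measureReal_nonneg) (by simp [h])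
    rw [← inv_div W (p a), Real.logb_inv]
    field_simp
  · simp

/-! ### Stochastic matrices, harmonic functions and growth rates. -/

section Stochastic

open Matrix

variable {V : Type*} [Fintype V]

lemma mulVec_mono_of_nonneg {M : Matrix V V ℝ} (hM : ∀ i j, 0 ≤ M i j) {u v : V → ℝ}
    (h : ∀ i, u i ≤ v i) (i : V) : (M *ᵥ u) i ≤ (M *ᵥ v) i :=
  Finset.sum_le_sum fun j _ => mul_le_mul_of_nonneg_left (h j) (hM i j)

variable [DecidableEq V] {P : Matrix V V ℝ}

lemma mulVec_const_of_mem_rowStochastic {M : Matrix V V ℝ} (hM : M ∈ rowStochastic ℝ V) (c : ℝ)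
    (i : V) : (M *ᵥ fun _ => c) i = c := by
  simp [mulVec, dotProduct, ← Finset.sum_mul, sum_row_of_mem_rowStochastic hM]

/-- The average of the first `N` powers of a matrix. -/
noncomputable def cesaroPow (P : Matrix V V ℝ) (N : ℕ) : Matrix V V ℝ :=
  (N : ℝ)⁻¹ • ∑ k ∈ Finset.range N, P ^ k

lemma cesaroPow_apply (P : Matrix V V ℝ) (N : ℕ) (i j : V) :
    cesaroPow P N i j = (N : ℝ)⁻¹ * ∑ k ∈ Finset.range N, (P ^ k) i j := by
  simp [cesaroPow, Matrix.sum_apply]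

lemma cesaroPow_mulVec_apply (P : Matrix V V ℝ) (N : ℕ) (v : V → ℝ) (i : V) :
    (cesaroPow P N *ᵥ v) i = (N : ℝ)⁻¹ * ∑ k ∈ Finset.range N, (P ^ k *ᵥ v) i := by
  simp [cesaroPow, smul_mulVec, Matrix.sum_mulVec]

lemma cesaroPow_mem_rowStochastic (hP : P ∈ rowStochastic ℝ V) {N : ℕ} (hN : N ≠ 0) :
    cesaroPow P N ∈ rowStochastic ℝ V := by
  rw [mem_rowStochastic_iff_sum]
  refine ⟨fun i j => ?_, fun i => ?_⟩
  · rw [cesaroPow_apply]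
    exact mul_nonneg (by positivity) (Finset.sum_nonneg fun k _ =>
      nonneg_of_mem_rowStochastic (pow_mem hP k))
  · simp only [cesaroPow_apply, ← Finset.mul_sum]
    rw [Finset.sum_comm, Finset.sum_congr rfl fun k _ =>
      sum_row_of_mem_rowStochastic (pow_mem hP k) i]
    simp [hN]

lemma isClosed_rowStochastic : IsClosed (rowStochastic ℝ V : Set (Matrix V V ℝ)) := by
  have : (rowStochastic ℝ V : Set (Matrix V V ℝ)) =
      (⋂ i, ⋂ j, {M : Matrix V V ℝ | 0 ≤ M i j}) ∩ ⋂ i, {M : Matrix V V ℝ | ∑ j, M i j = 1} := by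
    ext M
    simp [mem_rowStochastic_iff_sum]
  rw [this]
  refine (isClosed_iInter fun i => isClosed_iInter fun j => ?_).inter (isClosed_iInter fun i => ?_)
  · exact isClosed_le continuous_const (by fun_prop)
  · exact isClosed_eq (by fun_prop) continuous_const

lemma isCompact_rowStochastic : IsCompact (rowStochastic ℝ V : Set (Matrix V V ℝ)) := by
  refine IsCompact.of_isClosed_subset (s := Set.pi Set.univ fun _ : V => Set.pi Set.univ fun _ : V =>
    Set.Icc (0 : ℝ) 1) (isCompact_univ_pi fun _ => isCompact_univ_pi fun _ => isCompact_Icc)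
    isClosed_rowStochastic ?_
  intro M hM i _ j _
  exact ⟨nonneg_of_mem_rowStochastic hM, le_one_of_mem_rowStochastic hM⟩

/-- The Cesàro averages of the powers of a stochastic matrix have a limit point, and its rows are
stationary distributions. -/
lemma exists_tendsto_cesaroPow (hP : P ∈ rowStochastic ℝ V) :
    ∃ Q ∈ rowStochastic ℝ V, Q * P = Q ∧ ∃ φ : ℕ → ℕ, (∀ n, φ n ≠ 0) ∧
      Tendsto (fun n => cesaroPow P (φ n)) atTop (𝓝 Q) := by
  have : FirstCountableTopology (Matrix V V ℝ) :=
    inferInstanceAs (FirstCountableTopology (V → V → ℝ))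
  obtain ⟨Q, hQ, ψ, hψ, hlim⟩ := isCompact_rowStochastic.tendsto_subseq
    (x := fun n => cesaroPow P (n + 1)) fun n => cesaroPow_mem_rowStochastic hP n.succ_ne_zero
  refine ⟨Q, hQ, ?_, fun n => ψ n + 1, fun n => Nat.succ_ne_zero _, hlim⟩
  have h1 : Tendsto (fun n => cesaroPow P (ψ n + 1) * P) atTop (𝓝 (Q * P)) := by
    have hc : Continuous fun M : Matrix V V ℝ => M * P := by fun_prop
    exact (hc.tendsto Q).comp hlim
  have hinv : Tendsto (fun n => ((ψ n + 1 : ℕ) : ℝ)⁻¹) atTop (𝓝 0) :=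
    tendsto_inv_atTop_zero.comp (tendsto_natCast_atTop_atTop.comp
      ((tendsto_add_atTop_nat 1).comp hψ.tendsto_atTop))
  ext i j
  have h2 : Tendsto (fun n => (cesaroPow P (ψ n + 1) * P) i j - cesaroPow P (ψ n + 1) i j) atTop
      (𝓝 ((Q * P) i j - Q i j)) :=
    (((continuous_id.matrix_elem i j).tendsto _).comp h1).sub
      (((continuous_id.matrix_elem i j).tendsto _).comp hlim)
  have h3 : Tendsto (fun n => (cesaroPow P (ψ n + 1) * P) i j - cesaroPow P (ψ n + 1) i j) atTop
      (𝓝 0) := by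
    refine squeeze_zero_norm (fun n => ?_) hinv
    -- Telescoping: an average over N powers is P-invariant up to (P^N - 1) / N, whose entries are
    -- at most 1 / N in absolute value.
    have : cesaroPow P (ψ n + 1) * P - cesaroPow P (ψ n + 1) =
        ((ψ n + 1 : ℕ) : ℝ)⁻¹ • (P ^ (ψ n + 1) - 1) := by
      rw [cesaroPow, smul_mul_assoc, Finset.sum_mul, ← smul_sub, ← Finset.sum_sub_distrib]
      simp only [← pow_succ]
      rw [Finset.sum_range_sub (fun k => P ^ k), pow_zero]
    rw [← Matrix.sub_apply, this, Matrix.smul_apply, smul_eq_mul, norm_mul, Real.norm_of_nonneg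
      (by positivity)]
    refine mul_le_of_le_one_right (by positivity) ?_
    have hp := pow_mem hP (ψ n + 1)
    have ho : (1 : Matrix V V ℝ) ∈ rowStochastic ℝ V := one_mem _
    rw [Matrix.sub_apply, Real.norm_eq_abs, abs_le]
    have a1 := nonneg_of_mem_rowStochastic hp (i := i) (j := j)
    have a2 := le_one_of_mem_rowStochastic hp (i := i) (j := j)
    have a3 := nonneg_of_mem_rowStochastic ho (i := i) (j := j)
    have a4 := le_one_of_mem_rowStochastic ho (i := i) (j := j)
    constructor <;> linarith
  exact sub_eq_zero.1 (tendsto_nhds_unique h2 h3)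

/-- Powers of a stochastic matrix do not leave a closed set of states. -/
lemma pow_apply_eq_zero_of_closed {C : Set V} (hC : ∀ i ∈ C, ∀ j ∉ C, P i j = 0) (n : ℕ) {i j : V}
    (hi : i ∈ C) (hj : j ∉ C) : (P ^ n) i j = 0 := by
  induction n generalizing j with
  | zero => rw [pow_zero, one_apply_ne]; rintro rfl; exact hj hi
  | succ n ih =>
    rw [pow_succ, mul_apply]
    refine Finset.sum_eq_zero fun k _ => ?_
    by_cases hk : k ∈ C
    · rw [hC k hk j hj, mul_zero]
    · rw [ih hk, zero_mul]

/-- If `L` is harmonic, nonnegative and zero at `i`, it is zero wherever `P` leads from `i`. -/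
lemma harmonic_eq_zero_of_reflTransGen (hP : P ∈ rowStochastic ℝ V) {L : V → ℝ} (hL : P *ᵥ L = L)
    (h0 : ∀ i, 0 ≤ L i) {i j : V} (hij : Relation.ReflTransGen (fun i j => 0 < P i j) i j)
    (hi : L i = 0) : L j = 0 := by
  induction hij with
  | refl => exact hi
  | @tail j k _ hjk ih =>
    have h1 : ∑ k, P j k * L k = 0 := (congrFun hL j).trans ih
    have h2 := (Finset.sum_eq_zero_iff_of_nonneg fun k _ =>
      mul_nonneg (nonneg_of_mem_rowStochastic hP) (h0 k)).1 h1 k (Finset.mem_univ k)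
    exact (mul_eq_zero.1 h2).resolve_left hjk.ne'

/-- Growth rates of a sequence of functions that is additive along the powers of a stochastic matrix
up to a bounded error. -/
lemma exists_harmonic_rate (hP : P ∈ rowStochastic ℝ V) {e : ℕ → V → ℝ} {b c : ℝ}
    (h0 : ∀ n i, 0 ≤ e n i) (hb : ∀ n i, e n i ≤ b * n)
    (hlo : ∀ T S i, e T i + (P ^ T *ᵥ e S) i ≤ e (T + S) i)
    (hhi : ∀ T S i, e (T + S) i ≤ e T i + (P ^ T *ᵥ e S) i + c) :
    ∃ Q ∈ rowStochastic ℝ V, Q * P = Q ∧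
      (∀ C : Set V, (∀ i ∈ C, ∀ j ∉ C, P i j = 0) → ∀ i ∈ C, ∀ j ∉ C, Q i j = 0) ∧
      ∃ L : V → ℝ, (∀ i, Tendsto (fun n : ℕ => e n i / n) atTop (𝓝 (L i))) ∧ P *ᵥ L = L ∧
        ∀ n : ℕ, n ≠ 0 → ∀ i, (Q *ᵥ e n) i / n ≤ L i := by
  obtain ⟨Q, hQ, hQP, φ, hφ, hlim⟩ := exists_tendsto_cesaroPow hP
  have hQ0 : ∀ i j, 0 ≤ Q i j := fun i j => nonneg_of_mem_rowStochastic hQ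
  have hentry : ∀ i j, Tendsto (fun n => cesaroPow P (φ n) i j) atTop (𝓝 (Q i j)) := fun i j =>
    ((continuous_id.matrix_elem i j).tendsto _).comp hlim
  have hQpow : ∀ T, Q * P ^ T = Q := by
    intro T
    induction T with
    | zero => simp
    | succ T ih => rw [pow_succ, ← mul_assoc, ih, hQP]
  have hQlo : ∀ T S i, (Q *ᵥ e T) i + (Q *ᵥ e S) i ≤ (Q *ᵥ e (T + S)) i := by
    intro T S i
    have := mulVec_mono_of_nonneg hQ0 (u := e T + P ^ T *ᵥ e S) (hlo T S) i
    rwa [mulVec_add, mulVec_mulVec, hQpow] at this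
  have hQhi : ∀ T S i, (Q *ᵥ e (T + S)) i ≤ (Q *ᵥ e T) i + (Q *ᵥ e S) i + c := by
    intro T S i
    have := mulVec_mono_of_nonneg hQ0 (v := e T + P ^ T *ᵥ e S + fun _ => c) (hhi T S) i
    rwa [mulVec_add, mulVec_add, mulVec_mulVec, hQpow, Pi.add_apply, Pi.add_apply,
      mulVec_const_of_mem_rowStochastic hQ] at this
  have hQe0 : ∀ n i, 0 ≤ (Q *ᵥ e n) i := fun n i =>
    Finset.sum_nonneg fun j _ => mul_nonneg (hQ0 i j) (h0 n j)
  -- A node is needed as argument because `V` may be empty.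
  have hc : ∀ _i : V, 0 ≤ c := fun i => by
    have := hlo 0 0 i
    have := hhi 0 0 i
    linarith
  have hrate : ∀ i, ∃ l, Tendsto (fun n : ℕ => (Q *ᵥ e n) i / n) atTop (𝓝 l) := by
    intro i
    -- Adding the constant `c` absorbs the error term, so Fekete's lemma applies.
    have hsub : Subadditive fun n => (Q *ᵥ e n) i + c := fun m n => by
      have := hQhi m n i
      linarith
    have hbdd : BddBelow (Set.range fun n : ℕ => ((Q *ᵥ e n) i + c) / n) := by
      refine ⟨0, ?_⟩
      rintro _ ⟨n, rfl⟩
      exact div_nonneg (add_nonneg (hQe0 n i) (hc i)) n.cast_nonneg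
    refine ⟨hsub.lim, ?_⟩
    have h1 := (hsub.tendsto_lim hbdd).sub (tendsto_const_div_atTop_nhds_zero_nat c)
    rw [sub_zero] at h1
    refine h1.congr fun n => ?_
    rw [← sub_div, add_sub_cancel_right]
  choose L hL using hrate
  have hLge : ∀ n : ℕ, n ≠ 0 → ∀ i, (Q *ᵥ e n) i / n ≤ L i := by
    intro n hn i
    -- Superadditivity along multiples of n: every Q e_n / n bounds the limit from below.
    have hmul : ∀ m : ℕ, (m : ℝ) * (Q *ᵥ e n) i ≤ (Q *ᵥ e (m * n)) i := by
      intro m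
      induction m with
      | zero => simpa using hQe0 0 i
      | succ m ih =>
        have := hQlo (m * n) n i
        rw [Nat.succ_mul]
        push_cast
        linarith
    have ht : Tendsto (fun m : ℕ => m * n) atTop atTop :=
      tendsto_id.atTop_mul_const' (Nat.pos_of_ne_zero hn)
    refine ge_of_tendsto ((hL i).comp ht) ?_
    filter_upwards [eventually_gt_atTop 0] with m hm
    have hm' : (0 : ℝ) < m := by exact_mod_cast hm
    have hn' : (0 : ℝ) < n := by exact_mod_cast Nat.pos_of_ne_zero hn
    simp only [Function.comp_apply, Nat.cast_mul]
    rw [div_le_div_iff₀ hn' (by positivity)]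
    have := mul_le_mul_of_nonneg_right (hmul m) hn'.le
    linarith
  have hpowbd : ∀ n T i, (P ^ n *ᵥ e T) i ≤ b * T := fun n T i =>
    (mulVec_mono_of_nonneg (fun i j => nonneg_of_mem_rowStochastic (pow_mem hP n)) (hb T) i).trans
      (mulVec_const_of_mem_rowStochastic (pow_mem hP n) _ i).le
  have hpow0 : ∀ n T i, 0 ≤ (P ^ n *ᵥ e T) i := fun n T i =>
    Finset.sum_nonneg fun j _ => mul_nonneg (nonneg_of_mem_rowStochastic (pow_mem hP n)) (h0 T j)
  -- Splitting T + n both ways compares e_T + P^T e_n with e_n + P^n e_T; the terms with e_T lie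
  -- between 0 and b T.
  have hshift : ∀ (T n : ℕ) i, |e n i - (P ^ T *ᵥ e n) i| ≤ b * T + c := by
    intro T n i
    have h1 := hlo T n i
    have h2 := hhi T n i
    have h3 := hlo n T i
    have h4 := hhi n T i
    have h5 := hpowbd n T i
    have h6 := hpow0 n T i
    have h7 := hb T i
    have h8 := h0 T i
    rw [add_comm n T] at h3 h4
    rw [abs_le]
    constructor <;> linarith
  have hdiff : ∀ i, Tendsto (fun n : ℕ => e n i / n - (Q *ᵥ e n) i / n) atTop (𝓝 0) := by
    intro i
    have hb0 : 0 ≤ b := by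
      have h1 := hb 1 i
      have h2 := h0 1 i
      simp only [Nat.cast_one, mul_one] at h1
      linarith
    have hsum : Tendsto (fun n => b * ∑ j, |cesaroPow P (φ n) i j - Q i j|) atTop (𝓝 0) := by
      have : Tendsto (fun n => b * ∑ j, |cesaroPow P (φ n) i j - Q i j|) atTop
          (𝓝 (b * ∑ j, |Q i j - Q i j|)) :=
        (tendsto_finsetSum _ fun j _ => ((hentry i j).sub_const _).abs).const_mul b
      simpa using this
    rw [Metric.tendsto_nhds]
    intro ε hε
    -- One Cesàro average M of fixed length N, close to Q, is the intermediary: e_n - M e_n is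
    -- bounded in n, and M e_n - Q e_n is at most ε n / 2.
    obtain ⟨m, hm⟩ := ((tendsto_order.1 hsum).2 (ε / 2) (by positivity)).exists
    set N := φ m with hN
    have hN0 : (0 : ℝ) < N := by exact_mod_cast Nat.pos_of_ne_zero (hφ m)
    have hces : ∀ n, |e n i - (cesaroPow P N *ᵥ e n) i| ≤ b * N + c := by
      intro n
      have h1 : e n i - (cesaroPow P N *ᵥ e n) i =
          (N : ℝ)⁻¹ * ∑ k ∈ Finset.range N, (e n i - (P ^ k *ᵥ e n) i) := by
        rw [cesaroPow_mulVec_apply, Finset.sum_sub_distrib, mul_sub]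
        simp [hN0.ne']
      rw [h1, abs_mul, abs_of_pos (inv_pos.2 hN0), inv_mul_le_iff₀ hN0]
      calc |∑ k ∈ Finset.range N, (e n i - (P ^ k *ᵥ e n) i)|
          ≤ ∑ k ∈ Finset.range N, |e n i - (P ^ k *ᵥ e n) i| := Finset.abs_sum_le_sum_abs _ _
        _ ≤ ∑ _k ∈ Finset.range N, (b * N + c) := by
            refine Finset.sum_le_sum fun k hk => (hshift k n i).trans ?_
            have : (k : ℝ) ≤ N := by exact_mod_cast (Finset.mem_range.1 hk).le
            gcongr
        _ = N * (b * N + c) := by simp [mul_add]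
    have hQd : ∀ n, |(cesaroPow P N *ᵥ e n) i - (Q *ᵥ e n) i| ≤ ε / 2 * n := by
      intro n
      rw [mulVec, mulVec, dotProduct, dotProduct, ← Finset.sum_sub_distrib]
      calc |∑ j, (cesaroPow P N i j * e n j - Q i j * e n j)|
          ≤ ∑ j, |cesaroPow P N i j * e n j - Q i j * e n j| := Finset.abs_sum_le_sum_abs _ _
        _ ≤ ∑ j, |cesaroPow P N i j - Q i j| * (b * n) := by
            refine Finset.sum_le_sum fun j _ => ?_
            rw [← sub_mul, abs_mul, abs_of_nonneg (h0 n j)]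
            exact mul_le_mul_of_nonneg_left (hb n j) (abs_nonneg _)
        _ = (b * ∑ j, |cesaroPow P N i j - Q i j|) * n := by rw [← Finset.sum_mul]; ring
        _ ≤ ε / 2 * n := by gcongr
    have hz := tendsto_const_div_atTop_nhds_zero_nat (b * N + c)
    filter_upwards [(tendsto_order.1 hz).2 (ε / 2) (by positivity), eventually_gt_atTop 0]
      with n hn hn0
    have hn' : (0 : ℝ) < n := by exact_mod_cast hn0
    rw [div_lt_iff₀ hn'] at hn
    rw [Real.dist_eq, sub_zero, ← sub_div, abs_div, abs_of_pos hn', div_lt_iff₀ hn']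
    have := abs_sub_le (e n i) ((cesaroPow P N *ᵥ e n) i) ((Q *ᵥ e n) i)
    have := hces n
    have := hQd n
    linarith
  have hLe : ∀ i, Tendsto (fun n : ℕ => e n i / n) atTop (𝓝 (L i)) := fun i => by
    simpa using (hdiff i).add (hL i)
  refine ⟨Q, hQ, hQP, ?_, L, hLe, ?_, hLge⟩
  · intro C hC i hi j hj
    refine tendsto_nhds_unique (hentry i j) ?_
    have : ∀ n, cesaroPow P (φ n) i j = 0 := fun n => by
      rw [cesaroPow_apply, Finset.sum_eq_zero fun k _ => pow_apply_eq_zero_of_closed hC k hi hj,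
        mul_zero]
    simp only [this]
    exact tendsto_const_nhds
  · ext i
    have h1 : Tendsto (fun n : ℕ => (P *ᵥ e n) i / n) atTop (𝓝 ((P *ᵥ L) i)) := by
      have : Tendsto (fun n : ℕ => ∑ j, P i j * (e n j / n)) atTop (𝓝 (∑ j, P i j * L j)) :=
        tendsto_finsetSum _ fun j _ => (hLe j).const_mul _
      refine this.congr fun n => ?_
      simp only [mulVec, dotProduct, Finset.sum_div, mul_div_assoc]
    -- The one-step case of `hshift` makes the limit harmonic.
    have h2 : Tendsto (fun n : ℕ => e n i / n - (P *ᵥ e n) i / n) atTop (𝓝 0) := by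
      refine squeeze_zero_norm (fun n => ?_)
        (tendsto_const_div_atTop_nhds_zero_nat (b * (1 : ℕ) + c))
      rw [← sub_div, norm_div, Real.norm_natCast, Real.norm_eq_abs]
      have := hshift 1 n i
      rw [pow_one] at this
      gcongr
    have h3 := (hLe i).sub h1
    exact (sub_eq_zero.1 (tendsto_nhds_unique h3 h2)).symm

end Stochastic

/-! ### Path weights and the entropy of paths with known endpoints. -/

section Paths

open Matrix

variable {V Φ : Type*}

/-- The product of the transition weights along the path that starts at a node and continues with
the nodes of a list. -/
def pathWeight (P : Matrix V V ℝ) : V → List V → ℝ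
  | _, [] => 1
  | i, j :: l => P i j * pathWeight P j l

/-- The last node of the path that starts at a node and continues with the nodes of a list. -/
def pathEnd : V → List V → V
  | i, [] => i
  | _, j :: l => pathEnd j l

lemma pathWeight_append (P : Matrix V V ℝ) (i : V) (l m : List V) :
    pathWeight P i (l ++ m) = pathWeight P i l * pathWeight P (pathEnd i l) m := by
  induction l generalizing i with
  | nil => simp [pathWeight, pathEnd]
  | cons j l ih => simp [pathWeight, pathEnd, ih, mul_assoc]

lemma pathEnd_append (i : V) (l m : List V) :
    pathEnd i (l ++ m) = pathEnd (pathEnd i l) m := by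
  induction l generalizing i with
  | nil => rfl
  | cons j l ih => exact ih j

lemma pathWeight_ofFn_tail (P : Matrix V V ℝ) {n : ℕ} (z : Fin (n + 1) → V) :
    pathWeight P (z 0) (List.ofFn (Fin.tail z)) = ∏ t : Fin n, P (z t.castSucc) (z t.succ) := by
  induction n with
  | zero => simp [pathWeight]
  | succ n ih =>
    rw [List.ofFn_succ, pathWeight, Fin.prod_univ_succ]
    exact congrArg _ (ih (Fin.tail z))

lemma pathEnd_ofFn_tail {n : ℕ} (z : Fin (n + 1) → V) :
    pathEnd (z 0) (List.ofFn (Fin.tail z)) = z (Fin.last n) := by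
  induction n with
  | zero => simp [pathEnd]
  | succ n ih =>
    rw [List.ofFn_succ, pathEnd]
    exact ih (Fin.tail z)

/-- The entropy of an `n`-step path from `i`, given the colors of its nodes and its last node. -/
noncomputable def bridgeEntropy [Fintype V] (P : Matrix V V ℝ) (color : V → Φ) (n : ℕ) (i : V) :
    ℝ :=
  fiberEntropy (fun x : Fin n → V => pathWeight P i (List.ofFn x))
    fun x => ((List.ofFn x).map color, pathEnd i (List.ofFn x))

variable [Fintype V] [DecidableEq V] {P : Matrix V V ℝ}

lemma pathWeight_nonneg (hP : P ∈ rowStochastic ℝ V) (i : V) (l : List V) :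
    0 ≤ pathWeight P i l := by
  induction l generalizing i with
  | nil => exact zero_le_one
  | cons j l ih => exact mul_nonneg (nonneg_of_mem_rowStochastic hP) (ih j)

lemma sum_pathWeight_mul (P : Matrix V V ℝ) (n : ℕ) (f : V → ℝ) (i : V) :
    ∑ x : Fin n → V, pathWeight P i (List.ofFn x) * f (pathEnd i (List.ofFn x)) =
      (P ^ n *ᵥ f) i := by
  induction n generalizing i with
  | zero => simp [pathWeight, pathEnd]
  | succ n ih =>
    rw [← (Fin.consEquiv fun _ => V).sum_comp, Fintype.sum_prod_type, pow_succ', ← mulVec_mulVec]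
    change _ = ∑ j, P i j * _
    refine Finset.sum_congr rfl fun j _ => ?_
    rw [← ih j, Finset.mul_sum]
    refine Finset.sum_congr rfl fun x _ => ?_
    simp [Fin.consEquiv, List.ofFn_succ, pathWeight, pathEnd, mul_assoc]

lemma sum_pathWeight (hP : P ∈ rowStochastic ℝ V) (n : ℕ) (i : V) :
    ∑ x : Fin n → V, pathWeight P i (List.ofFn x) = 1 := by
  have := sum_pathWeight_mul P n (fun _ => 1) i
  rw [mulVec_const_of_mem_rowStochastic (pow_mem hP n)] at this
  simpa using this

lemma bridgeEntropy_nonneg (hP : P ∈ rowStochastic ℝ V) (color : V → Φ) (n : ℕ) (i : V) :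
    0 ≤ bridgeEntropy P color n i :=
  fiberEntropy_nonneg (fun _ => pathWeight_nonneg hP i _) _

lemma bridgeEntropy_le (hP : P ∈ rowStochastic ℝ V) (color : V → Φ) (n : ℕ) (i : V) :
    bridgeEntropy P color n i ≤ Real.logb 2 (Fintype.card V) * n := by
  classical
  have : Nonempty V := ⟨i⟩
  have hV : (0 : ℝ) < Fintype.card V := by exact_mod_cast Fintype.card_pos
  rw [mul_comm, ← Real.logb_pow]
  refine fiberEntropy_le_logb (fun _ => pathWeight_nonneg hP i _) (sum_pathWeight hP n i)
    (by positivity) fun x _ => ?_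
  refine le_trans (Nat.cast_le.2 (Finset.card_le_univ _)) ?_
  simp

/-- Inserting the node at time `T` splits the entropy of a path of length `T + S`. -/
lemma bridgeEntropy_add (hP : P ∈ rowStochastic ℝ V) (color : V → Φ) (T S : ℕ) (i : V) :
    bridgeEntropy P color T i + (P ^ T *ᵥ bridgeEntropy P color S) i ≤
        bridgeEntropy P color (T + S) i ∧
      bridgeEntropy P color (T + S) i ≤ bridgeEntropy P color T i +
        (P ^ T *ᵥ bridgeEntropy P color S) i + Real.logb 2 (Fintype.card V) := by
  have hw : ∀ j l, 0 ≤ pathWeight P j l := pathWeight_nonneg hP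
  have hsplit := fiberEntropy_prod (q := fun x : Fin T → V => pathWeight P i (List.ofFn x))
    (r := fun j (x : Fin S → V) => pathWeight P j (List.ofFn x)) (fun _ => hw _ _)
    (fun _ _ => hw _ _) (sum_pathWeight hP S) (fun x => pathEnd i (List.ofFn x))
    (fun x => (List.ofFn x).map color)
    (fun j x => ((List.ofFn x).map color, pathEnd j (List.ofFn x)))
  have hsum := sum_pathWeight_mul P T (bridgeEntropy P color S) i
  rw [← hsum]
  change _ = bridgeEntropy P color T i + ∑ x : Fin T → V, pathWeight P i (List.ofFn x) *
    bridgeEntropy P color S (pathEnd i (List.ofFn x)) at hsplit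
  rw [← hsplit]
  have hjoin : bridgeEntropy P color (T + S) i =
      fiberEntropy (fun x : (Fin T → V) × (Fin S → V) => pathWeight P i (List.ofFn x.1) *
        pathWeight P (pathEnd i (List.ofFn x.1)) (List.ofFn x.2))
        fun x => ((List.ofFn x.1).map color ++ (List.ofFn x.2).map color,
          pathEnd (pathEnd i (List.ofFn x.1)) (List.ofFn x.2)) := by
    rw [bridgeEntropy, ← fiberEntropy_comp_equiv (Fin.appendEquiv T S)]
    congr 1
    · ext x
      simp [Fin.appendEquiv, List.ofFn_fin_append, pathWeight_append]
    · ext x : 1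
      simp only [Fin.appendEquiv, Function.comp_apply, Equiv.coe_fn_mk, List.ofFn_fin_append,
        pathEnd_append, List.map_append]
  have hp : ∀ x : (Fin T → V) × (Fin S → V), 0 ≤ pathWeight P i (List.ofFn x.1) *
      pathWeight P (pathEnd i (List.ofFn x.1)) (List.ofFn x.2) := fun x => mul_nonneg (hw _ _) (hw _ _)
  rw [hjoin]
  constructor
  -- Knowing the node at time T as well refines the conditioning.
  · refine fiberEntropy_anti hp ?_
    intro x x' h
    simp only [Prod.mk.injEq] at h ⊢
    obtain ⟨⟨h1, -⟩, h2, h3⟩ := h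
    exact ⟨by rw [h1, h2], h3⟩
  -- The node at time T is the only information gained; the color word splits uniquely because its
  -- first part has length T.
  · refine fiberEntropy_le_add_logb_card hp ?_ (fun x => pathEnd i (List.ofFn x.1)) ?_
    · rw [Fintype.sum_prod_type]
      simp only [← Finset.mul_sum, sum_pathWeight hP, mul_one]
    · intro x x' h hk
      simp only [Prod.mk.injEq] at h ⊢
      obtain ⟨h1, h2⟩ := List.append_inj h.1 (by simp)
      exact ⟨⟨h1, hk⟩, h2, h.2⟩

lemma forall_pos_of_pathWeight_pos (hP : P ∈ rowStochastic ℝ V) {n : ℕ} {z : Fin (n + 1) → V}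
    (h : 0 < pathWeight P (z 0) (List.ofFn (Fin.tail z))) (t : Fin n) :
    0 < P (z t.castSucc) (z t.succ) := by
  rw [pathWeight_ofFn_tail] at h
  exact (nonneg_of_mem_rowStochastic hP).lt_of_ne'
    (Finset.prod_ne_zero_iff.1 h.ne' t (Finset.mem_univ t))

end Paths

/-! ### Recurrence, and entropy against the number of hypotheses. -/

namespace WeakModel

variable {V Φ : Type*} {G : WeakModel V Φ}

lemma Accessible.trans {i j k : V} (h : G.Accessible i j) (h' : G.Accessible j k) :
    G.Accessible i k :=
  Relation.ReflTransGen.trans h h'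

lemma accessible_of_forall_adj {n : ℕ} {z : Fin (n + 1) → V}
    (h : ∀ t : Fin n, G.Adj (z t.castSucc) (z t.succ)) (t : Fin (n + 1)) :
    G.Accessible (z 0) (z t) := by
  induction t using Fin.induction with
  | zero => exact Relation.ReflTransGen.refl
  | succ t ih => exact ih.tail (h t)

/-- In a finite graph some recurrent node is accessible from each node. -/
lemma exists_accessible_recurrent [Finite V] (G : WeakModel V Φ) (i : V) :
    ∃ j, G.Accessible i j ∧ G.Recurrent j := by
  -- A node with the fewest accessible nodes is recurrent: anything it reaches has a subset of
  -- these, hence all of them.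
  obtain ⟨j, hj, hmin⟩ := Set.exists_min_image {j | G.Accessible i j}
    (fun j => {k | G.Accessible j k}.ncard) (Set.toFinite _) ⟨i, Relation.ReflTransGen.refl⟩
  refine ⟨j, hj, fun k hk => ?_⟩
  have hsub : {l | G.Accessible k l} ⊆ {l | G.Accessible j l} := fun l hl => hk.trans hl
  have heq := Set.eq_of_subset_of_ncard_le hsub (hmin k (Accessible.trans hj hk)) (Set.toFinite _)
  have : j ∈ {l | G.Accessible k l} := heq ▸ Relation.ReflTransGen.refl
  exact this

lemma bddAbove_ncard_hypotheses [Finite V] (G : WeakModel V Φ) (t : ℕ) :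
    BddAbove (Set.range fun y : Fin t → Φ => (G.hypotheses y).ncard) := by
  refine ⟨Nat.card (Fin t → V), ?_⟩
  rintro _ ⟨y, rfl⟩
  exact Set.ncard_le_card _

lemma ncard_hypotheses_le [Finite V] (G : WeakModel V Φ) {t : ℕ} (y : Fin t → Φ) :
    (G.hypotheses y).ncard ≤ G.maxHypotheses t :=
  le_ciSup (bddAbove_ncard_hypotheses G t) y

lemma trackable_of_maxHypotheses_le {C : Set V} {K : ℕ}
    (h : ∀ n, (G.induce C).maxHypotheses (n + 1) ≤ K) : (G.induce C).Trackable := by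
  refine ⟨0, IsBigO.of_bound K ?_⟩
  filter_upwards [eventually_ge_atTop 1] with t ht
  obtain ⟨n, rfl⟩ := Nat.exists_eq_add_of_le' ht
  simpa using h n

variable [Fintype V] [DecidableEq V] {P : Matrix V V ℝ}

/-- In a set of nodes that no edge leaves, the entropy of a path is at most the logarithm of the
worst-case number of hypotheses. -/
lemma bridgeEntropy_le_logb_maxHypotheses (hP : P ∈ Matrix.rowStochastic ℝ V)
    (hPG : ∀ i j, G.Adj i j ↔ 0 < P i j) {C : Set V} (hC : ∀ i ∈ C, ∀ j, G.Accessible i j → j ∈ C)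
    {i : V} (hi : i ∈ C) {n : ℕ} {N : ℝ} (hN : 0 < N)
    (h : ((G.induce C).maxHypotheses (n + 1) : ℝ) ≤ N) :
    bridgeEntropy P G.color n i ≤ Real.logb 2 N := by
  classical
  refine fiberEntropy_le_logb (fun _ => pathWeight_nonneg hP i _) (sum_pathWeight hP n i) hN
    fun x _ => le_trans (Nat.cast_le.2 ?_) h
  refine le_trans ?_ ((G.induce C).ncard_hypotheses_le
    fun t => G.color ((Fin.cons i x : Fin (n + 1) → V) t))
  -- Prepending i turns each n-step path into a hypothesis of length n + 1 inside `C`; taking the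
  -- tail recovers the path.
  rw [← Set.ncard_coe_finset]
  refine le_trans (Set.ncard_le_ncard ?_ (Set.toFinite _))
    (Set.ncard_image_le (f := fun z : Fin (n + 1) → C => Fin.tail fun t => (z t : V))
      (Set.toFinite _))
  intro x' hx'
  simp only [Finset.coe_filter, Finset.mem_univ, true_and, Set.mem_ofPred_eq, Prod.mk.injEq] at hx'
  obtain ⟨⟨hcol, -⟩, hpos⟩ := hx'
  have hadj : ∀ t : Fin n, G.Adj ((Fin.cons i x' : Fin (n + 1) → V) t.castSucc)
      ((Fin.cons i x' : Fin (n + 1) → V) t.succ) := fun t => (hPG _ _).2 <|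
    forall_pos_of_pathWeight_pos hP (z := (Fin.cons i x' : Fin (n + 1) → V))
      (by simpa using hpos) t
  have hmem : ∀ t, (Fin.cons i x' : Fin (n + 1) → V) t ∈ C := fun t =>
    hC i hi _ (accessible_of_forall_adj hadj t)
  refine ⟨fun t => ⟨_, hmem t⟩, ⟨fun t => ?_, fun s t hst => ?_⟩, ?_⟩
  · change G.color _ = G.color _
    rw [List.map_ofFn, List.map_ofFn, List.ofFn_inj] at hcol
    refine Fin.cases rfl (fun t => ?_) t
    exact congrFun hcol t
  · change G.Adj _ _
    have hs : (s : ℕ) < n := by omega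
    have h2 : t = (⟨s, hs⟩ : Fin n).succ := Fin.ext hst
    subst h2
    exact hadj ⟨s, hs⟩
  · simp

/-- If paths are determined by their colors and endpoints, then the number of hypotheses is
bounded. -/
lemma maxHypotheses_le_of_bridgeEntropy_eq_zero (hP : P ∈ Matrix.rowStochastic ℝ V)
    (hPG : ∀ i j, G.Adj i j ↔ 0 < P i j) {C : Set V} {n : ℕ}
    (h : ∀ i ∈ C, bridgeEntropy P G.color n i = 0) :
    (G.induce C).maxHypotheses (n + 1) ≤ Fintype.card (V × V) := by
  refine ciSup_le' fun y => ?_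
  rw [← Nat.card_eq_fintype_card, ← Set.ncard_univ]
  -- Two hypotheses with the same endpoints would be two paths of positive weight in one fiber,
  -- forcing positive entropy.
  refine Set.ncard_le_ncard_of_injOn (fun z => ((z 0 : V), (z (Fin.last n) : V)))
    (fun _ _ => Set.mem_univ _) ?_ (Set.toFinite _)
  have hpos : ∀ z ∈ (G.induce C).hypotheses y,
      0 < pathWeight P (z 0 : V) (List.ofFn (Fin.tail fun t => (z t : V))) := fun z hz => by
    rw [pathWeight_ofFn_tail P fun t => (z t : V)]
    exact Finset.prod_pos fun t _ => (hPG _ _).1 (hz.2 t.castSucc t.succ (by simp))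
  intro z hz z' hz' heq
  simp only [Prod.mk.injEq] at heq
  by_contra hne
  have htail : (Fin.tail fun t => (z t : V)) ≠ Fin.tail fun t => (z' t : V) := by
    intro ht
    refine hne (funext fun t => Subtype.ext ?_)
    exact Fin.cases heq.1 (fun t => congrFun ht t) t
  refine (fiberEntropy_pos
    (p := fun x : Fin n → V => pathWeight P (z 0 : V) (List.ofFn x))
    (g := fun x => ((List.ofFn x).map G.color, pathEnd (z 0 : V) (List.ofFn x)))
    (fun _ => pathWeight_nonneg hP _ _) htail ?_ (hpos z hz) ?_).ne' (h _ (z 0).2)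
  · simp only [Prod.mk.injEq]
    constructor
    · rw [List.map_ofFn, List.map_ofFn, List.ofFn_inj]
      funext t
      exact (hz.1 t.succ).trans (hz'.1 t.succ).symm
    · rw [pathEnd_ofFn_tail fun t => (z t : V), heq.1, pathEnd_ofFn_tail fun t => (z' t : V)]
      exact heq.2
  · have := hpos z' hz'
    rwa [← heq.1] at this

end WeakModel

lemma tendsto_logb_mul_pow_div (K : ℝ) (hK : 0 < K) (k : ℕ) :
    Tendsto (fun n : ℕ => Real.logb 2 (K * ((n + 1 : ℕ) : ℝ) ^ k) / n) atTop (𝓝 0) := by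
  have h1 : Tendsto (fun n : ℕ => Real.log ((n + 1 : ℕ) : ℝ) / n) atTop (𝓝 0) := by
    have := (Real.tendsto_pow_log_div_mul_add_atTop 1 (-1) 1 one_ne_zero).comp
      (tendsto_natCast_atTop_atTop.comp (tendsto_add_atTop_nat 1))
    refine this.congr fun n => ?_
    simp
  have h2 := (tendsto_const_div_atTop_nhds_zero_nat (Real.logb 2 K)).add
    (h1.const_mul (k / Real.log 2))
  rw [mul_zero, add_zero] at h2
  refine h2.congr fun n => ?_
  rw [Real.logb_mul hK.ne' (by positivity), Real.logb_pow, Real.logb, Real.logb]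
  ring

/-! ### From the chain to path entropies. -/

section MarkovChain

variable {V Φ Ω : Type*} [MeasurableSpace V] {P : Matrix V V ℝ} [MeasurableSpace Ω]
  {μ : Measure Ω} {X : ℕ → Ω → V}

lemma IsMarkovChain.measureReal_path (hX : IsMarkovChain μ P X) {S : ℕ} (z : Fin (S + 1) → V) :
    μ.real {ω | (fun t : Fin (S + 1) => X t ω) = z} =
      μ.real {ω | X 0 ω = z 0} * pathWeight P (z 0) (List.ofFn (Fin.tail z)) := by
  -- `Fin.ofNat` extends z periodically to ℕ; the values after time S play no role.
  have h := hX.law S fun t => z (Fin.ofNat (S + 1) t)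
  have hz : ∀ t : Fin (S + 1), Fin.ofNat (S + 1) (t : ℕ) = t := fun t => Fin.ext (by simp)
  rw [pathWeight_ofFn_tail]
  have h0 : Fin.ofNat (S + 1) 0 = 0 := hz 0
  rw [h0] at h
  convert h using 2
  · congr 1
    ext ω
    simp only [funext_iff]
    constructor
    · intro h t ht
      have := h (Fin.ofNat (S + 1) t)
      rwa [Fin.val_ofNat, Nat.mod_eq_of_lt (by omega)] at this
    · intro h t
      have := h t (by omega)
      rwa [hz] at this
  · rw [Finset.prod_range]
    refine Finset.prod_congr rfl fun t _ => ?_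
    have h1 := hz t.castSucc
    have h2 := hz t.succ
    rw [Fin.val_castSucc] at h1
    rw [Fin.val_succ] at h2
    rw [h1, h2]

variable [Fintype V] [DecidableEq V] [MeasurableSingletonClass V] [IsProbabilityMeasure μ]

/-- Up to a bounded error, the conditional entropy is the mean over the initial node of the
entropy of a path with given endpoints. -/
lemma IsMarkovChain.condEntropy_bounds (hX : IsMarkovChain μ P X)
    (hP : P ∈ Matrix.rowStochastic ℝ V) (color : V → Φ) (S : ℕ) :
    ∑ i, μ.real {ω | X 0 ω = i} * bridgeEntropy P color S i ≤
        condEntropy μ (fun ω (t : Fin (S + 1)) => X t ω)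
          (fun ω (t : Fin (S + 1)) => color (X t ω)) ∧
      condEntropy μ (fun ω (t : Fin (S + 1)) => X t ω)
          (fun ω (t : Fin (S + 1)) => color (X t ω)) ≤
        ∑ i, μ.real {ω | X 0 ω = i} * bridgeEntropy P color S i +
          Real.logb 2 (Fintype.card (V × V)) := by
  have hmeas : ∀ z : Fin (S + 1) → V, MeasurableSet {ω | (fun t : Fin (S + 1) => X t ω) = z} :=
    fun z => by
      simp only [funext_iff, Set.ofPred_forall]
      exact MeasurableSet.iInter fun t => hX.measurable t (measurableSet_singleton (z t))
  have hπ : ∑ i, μ.real {ω | X 0 ω = i} = 1 := by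
    have := sum_measureReal_preimage_singleton (μ := μ) (f := X 0) Finset.univ
      fun i _ => hX.measurable 0 (measurableSet_singleton i)
    rw [Finset.coe_univ, Set.preimage_univ, probReal_univ] at this
    exact this
  have hw : ∀ j l, 0 ≤ pathWeight P j l := pathWeight_nonneg hP
  have hsplit := fiberEntropy_prod (q := fun i => μ.real {ω | X 0 ω = i})
    (r := fun j (x : Fin S → V) => pathWeight P j (List.ofFn x)) (fun _ => measureReal_nonneg)
    (fun _ _ => hw _ _) (sum_pathWeight hP S) (fun i => i) (fun _ => ())
    (fun j x => ((List.ofFn x).map color, pathEnd j (List.ofFn x)))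
  -- The initial node is part of the conditioning and contributes no entropy, leaving only the mean
  -- path entropy.
  rw [fiberEntropy_congr (g := fun i : V => i) (by simp), fiberEntropy_id, zero_add] at hsplit
  change _ = ∑ i, μ.real {ω | X 0 ω = i} * bridgeEntropy P color S i at hsplit
  have hcond : condEntropy μ (fun ω (t : Fin (S + 1)) => X t ω)
      (fun ω (t : Fin (S + 1)) => color (X t ω)) =
      fiberEntropy (fun x : V × (Fin S → V) =>
        μ.real {ω | X 0 ω = x.1} * pathWeight P x.1 (List.ofFn x.2))
        fun x t => color ((Fin.cons x.1 x.2 : Fin (S + 1) → V) t) := by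
    rw [condEntropy_comp_eq_fiberEntropy μ (fun ω (t : Fin (S + 1)) => X t ω) hmeas
      fun z t => color (z t), ← fiberEntropy_comp_equiv (Fin.consEquiv fun _ => V)]
    congr 1
    ext x
    simp only [Function.comp_apply, hX.measureReal_path]
    simp [Fin.consEquiv]
  have hp : ∀ x : V × (Fin S → V), 0 ≤
      μ.real {ω | X 0 ω = x.1} * pathWeight P x.1 (List.ofFn x.2) :=
    fun x => mul_nonneg measureReal_nonneg (hw _ _)
  have hcol : ∀ x x' : V × (Fin S → V),
      ((fun t => color ((Fin.cons x.1 x.2 : Fin (S + 1) → V) t)) =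
        fun t => color ((Fin.cons x'.1 x'.2 : Fin (S + 1) → V) t)) ↔
      color x.1 = color x'.1 ∧ (List.ofFn x.2).map color = (List.ofFn x'.2).map color := by
    intro x x'
    rw [List.map_ofFn, List.map_ofFn, List.ofFn_inj, funext_iff, Fin.forall_fin_succ, funext_iff]
    simp
  rw [← hsplit, hcond]
  constructor
  · refine fiberEntropy_anti hp fun x x' h => ?_
    simp only [Prod.mk.injEq] at h
    rw [hcol]
    exact ⟨congrArg color h.1.2, h.2.1⟩
  · refine fiberEntropy_le_add_logb_card hp ?_
      (fun x => (x.1, pathEnd x.1 (List.ofFn x.2))) fun x x' h hk => ?_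
    · rw [Fintype.sum_prod_type]
      simp only [← Finset.mul_sum, sum_pathWeight hP, mul_one, hπ]
    · rw [hcol] at h
      simp only [Prod.mk.injEq] at hk ⊢
      exact ⟨⟨trivial, hk.1⟩, h.2, hk.2⟩

end MarkovChain

/-! ### The entropy rate and the criterion for its vanishing. -/

theorem theorem5 {V Φ Ω : Type*} [Fintype V] [DecidableEq V]
    [MeasurableSpace V] [MeasurableSingletonClass V]
    (G : WeakModel V Φ)
    (P : Matrix V V ℝ) (hP : P ∈ Matrix.rowStochastic ℝ V)
    (hPG : ∀ i j, G.Adj i j ↔ 0 < P i j)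
    [MeasurableSpace Ω] (μ : Measure Ω) [IsProbabilityMeasure μ]
    (X : ℕ → Ω → V) (hX : IsMarkovChain μ P X)
    (hvisit : ∀ C, G.IsRecurrentClass C → ∃ t, 0 < μ {ω | X t ω ∈ C})
    (haper : ∀ i, G.Recurrent i → G.Aperiodic i) :
    ∃ h : ℝ,
      Tendsto
        (fun T : ℕ => (1 / (T : ℝ)) *
          condEntropy μ (fun ω (t : Fin T) => X t ω) (fun ω (t : Fin T) => G.color (X t ω)))
        atTop (𝓝 h) ∧
      (h = 0 ↔ ∀ C, G.IsRecurrentClass C → (G.induce C).Trackable) := by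
  have he0 := bridgeEntropy_nonneg hP G.color
  obtain ⟨Q, hQ, hQP, hQC, L, hL, hPL, hLge⟩ := exists_harmonic_rate hP
    (e := bridgeEntropy P G.color) he0 (bridgeEntropy_le hP G.color)
    (fun T S i => (bridgeEntropy_add hP G.color T S i).1)
    (fun T S i => (bridgeEntropy_add hP G.color T S i).2)
  have hL0 : ∀ i, 0 ≤ L i := fun i =>
    ge_of_tendsto' (hL i) fun n => div_nonneg (he0 n i) n.cast_nonneg
  have hacc : ∀ i j, G.Accessible i j → Relation.ReflTransGen (fun i j => 0 < P i j) i j :=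
    fun i j h => Relation.ReflTransGen.mono (fun i j => (hPG i j).1) i j h
  set π : V → ℝ := fun i => μ.real {ω | X 0 ω = i} with hπ
  have hπ0 : ∀ i, 0 ≤ π i := fun i => measureReal_nonneg
  refine ⟨∑ i, π i * L i, ?_, ?_, ?_⟩
  -- T = S + 1 observations make S steps; the factor S / (S + 1) below corrects the normalization.
  · rw [← tendsto_add_atTop_iff_nat 1]
    set H : ℕ → ℝ := fun S => condEntropy μ (fun ω (t : Fin (S + 1)) => X t ω)
      (fun ω (t : Fin (S + 1)) => G.color (X t ω)) with hH
    have h1 : Tendsto (fun S : ℕ => (∑ i, π i * bridgeEntropy P G.color S i) / S) atTop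
        (𝓝 (∑ i, π i * L i)) := by
      have : Tendsto (fun S : ℕ => ∑ i, π i * (bridgeEntropy P G.color S i / S)) atTop
          (𝓝 (∑ i, π i * L i)) := tendsto_finsetSum _ fun i _ => (hL i).const_mul _
      refine this.congr fun S => ?_
      simp only [Finset.sum_div, mul_div_assoc]
    have h2 := h1.add (tendsto_const_div_atTop_nhds_zero_nat
      (Real.logb 2 (Fintype.card (V × V))))
    rw [add_zero] at h2
    have h3 : Tendsto (fun S : ℕ => H S / S) atTop (𝓝 (∑ i, π i * L i)) := by
      refine tendsto_of_tendsto_of_tendsto_of_le_of_le h1 h2 (fun S => ?_) fun S => ?_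
      · exact div_le_div_of_nonneg_right (hX.condEntropy_bounds hP G.color S).1 S.cast_nonneg
      · simp only [← add_div]
        exact div_le_div_of_nonneg_right (hX.condEntropy_bounds hP G.color S).2 S.cast_nonneg
    have h4 := h3.mul (tendsto_natCast_div_add_atTop (1 : ℝ))
    rw [mul_one] at h4
    refine h4.congr' ?_
    filter_upwards [eventually_gt_atTop 0] with S hS
    have : (0 : ℝ) < S := by exact_mod_cast hS
    change H S / S * (S / (S + 1)) = 1 / ((S + 1 : ℕ) : ℝ) * H S
    push_cast
    field_simp
  · rintro hzero C ⟨i, hi, rfl⟩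
    set C : Set V := {j | G.Accessible i j} with hC
    have hclosed : ∀ j ∈ C, ∀ k ∉ C, P j k = 0 := fun j hj k hk => by
      by_contra hne
      exact hk (Relation.ReflTransGen.tail hj
        ((hPG _ _).2 ((Matrix.nonneg_of_mem_rowStochastic hP).lt_of_ne' hne)))
    have hback : ∀ j ∈ C, ∀ k ∈ C, G.Accessible j k := fun j hj k hk => (hi j hj).trans hk
    -- a path of positive probability leads into `C`
    obtain ⟨t, ht⟩ := hvisit C ⟨i, hi, rfl⟩
    obtain ⟨j, hjC, k, hk, hkj⟩ : ∃ j ∈ C, ∃ k, 0 < π k ∧ G.Accessible k j := by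
      have hcover : {ω | X t ω ∈ C} = ⋃ z : Fin (t + 1) → V,
          {ω | X t ω ∈ C ∧ (fun s : Fin (t + 1) => X s ω) = z} := by
        ext ω
        simp
      rw [hcover] at ht
      obtain ⟨z, hz⟩ : ∃ z : Fin (t + 1) → V,
          μ {ω | X t ω ∈ C ∧ (fun s : Fin (t + 1) => X s ω) = z} ≠ 0 := by
        by_contra! hcon
        exact ht.ne' (measure_iUnion_null hcon)
      have hzC : z (Fin.last t) ∈ C := by
        obtain ⟨ω, hω, rfl⟩ := nonempty_of_measure_ne_zero hz
        exact hω
      have hpos : 0 < π (z 0) * pathWeight P (z 0) (List.ofFn (Fin.tail z)) := by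
        have h1 : π (z 0) * pathWeight P (z 0) (List.ofFn (Fin.tail z)) =
          μ.real {ω | (fun s : Fin (t + 1) => X s ω) = z} := (hX.measureReal_path z).symm
        rw [h1, measureReal_def, ENNReal.toReal_pos_iff]
        exact ⟨(pos_iff_ne_zero.2 hz).trans_le (measure_mono fun ω hω => hω.2), measure_lt_top _ _⟩
      have hw := pos_of_mul_pos_right hpos (hπ0 _)
      exact ⟨_, hzC, z 0, pos_of_mul_pos_left hpos (pathWeight_nonneg hP _ _),
        G.accessible_of_forall_adj (fun s => (hPG _ _).2 (forall_pos_of_pathWeight_pos hP hw s)) _⟩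
    have hLk : L k = 0 := by
      have := (Finset.sum_eq_zero_iff_of_nonneg fun i _ => mul_nonneg (hπ0 i) (hL0 i)).1 hzero k
        (Finset.mem_univ k)
      exact (mul_eq_zero.1 this).resolve_left hk.ne'
    have hLC : ∀ l ∈ C, L l = 0 := fun l hl =>
      harmonic_eq_zero_of_reflTransGen hP hPL hL0 (hacc _ _ (hkj.trans (hback j hjC l hl))) hLk
    have hQ0 : ∀ i j, 0 ≤ Q i j := fun i j => Matrix.nonneg_of_mem_rowStochastic hQ
    have hiC : i ∈ C := Relation.ReflTransGen.refl
    -- the stationary distribution in row `i` charges all of `C`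
    obtain ⟨j₀, hj₀⟩ : ∃ j, 0 < Q i j := by
      by_contra! hcon
      have h1 := Matrix.sum_row_of_mem_rowStochastic hQ i
      have h2 : ∑ j, Q i j ≤ 0 := Finset.sum_nonpos fun j _ => hcon j
      linarith
    have hj₀C : j₀ ∈ C := by
      by_contra hcon
      exact hj₀.ne' (hQC C hclosed i hiC j₀ hcon)
    have hQpos : ∀ l, Relation.ReflTransGen (fun i j => 0 < P i j) j₀ l → 0 < Q i l := by
      intro l hl
      induction hl with
      | refl => exact hj₀
      | @tail l m _ hlm ih =>
        calc 0 < Q i l * P l m := mul_pos ih hlm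
          _ ≤ ∑ l, Q i l * P l m := Finset.single_le_sum (f := fun l => Q i l * P l m)
            (fun l _ => mul_nonneg (hQ0 i l) (Matrix.nonneg_of_mem_rowStochastic hP))
            (Finset.mem_univ l)
          _ = Q i m := by rw [← Matrix.mul_apply, hQP]
    have hzero' : ∀ n, ∀ l ∈ C, bridgeEntropy P G.color n l = 0 := by
      intro n l hl
      rcases Nat.eq_zero_or_pos n with rfl | hn
      · have := bridgeEntropy_le hP G.color 0 l
        simp only [Nat.cast_zero, mul_zero] at this
        exact le_antisymm this (he0 0 l)
      · have hn' : (0 : ℝ) < n := by exact_mod_cast hn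
        have h1 := hLge n hn.ne' i
        rw [hLC i hiC, div_le_iff₀ hn', zero_mul] at h1
        have hnn : ∀ m, 0 ≤ Q i m * bridgeEntropy P G.color n m := fun m =>
          mul_nonneg (hQ0 i m) (he0 n m)
        have h2 : ∑ m, Q i m * bridgeEntropy P G.color n m = 0 :=
          le_antisymm h1 (Finset.sum_nonneg fun m _ => hnn m)
        have h3 := (Finset.sum_eq_zero_iff_of_nonneg fun m _ => hnn m).1 h2 l (Finset.mem_univ l)
        exact (mul_eq_zero.1 h3).resolve_left (hQpos l (hacc _ _ (hback j₀ hj₀C l hl))).ne'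
    exact WeakModel.trackable_of_maxHypotheses_le fun n =>
      WeakModel.maxHypotheses_le_of_bridgeEntropy_eq_zero hP hPG (hzero' n)
  · intro htrack
    have hrec : ∀ i, G.Recurrent i → L i = 0 := by
      intro i hi
      obtain ⟨k, hk⟩ := htrack _ ⟨i, hi, rfl⟩
      obtain ⟨K, hK, hbound⟩ := hk.exists_pos
      refine le_antisymm (le_of_tendsto_of_tendsto (hL i) (tendsto_logb_mul_pow_div K hK k) ?_)
        (hL0 i)
      filter_upwards [(tendsto_add_atTop_nat 1).eventually hbound.bound] with n hn
      refine div_le_div_of_nonneg_right ?_ n.cast_nonneg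
      refine WeakModel.bridgeEntropy_le_logb_maxHypotheses hP hPG
        (C := {j | G.Accessible i j}) (fun _ hj _ hjk => WeakModel.Accessible.trans hj hjk)
        Relation.ReflTransGen.refl (by positivity) ?_
      simpa only [Real.norm_natCast, norm_pow] using hn
    have hLzero : ∀ i, L i = 0 := by
      intro i
      have : Nonempty V := ⟨i⟩
      obtain ⟨m, hm⟩ := Finite.exists_max L
      obtain ⟨j, hmj, hj⟩ := G.exists_accessible_recurrent m
      -- Maximum principle: L m - L is harmonic, nonnegative and zero at the maximizer m, hence also
      -- at the recurrent node j, where L j = 0. So the maximum is 0.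
      have hharm : P.mulVec (fun l => L m - L l) = fun l => L m - L l := by
        change P.mulVec ((fun _ => L m) - L) = (fun _ => L m) - L
        rw [Matrix.mulVec_sub, hPL]
        congr 1
        ext l
        exact mulVec_const_of_mem_rowStochastic hP _ l
      have := harmonic_eq_zero_of_reflTransGen hP hharm (fun l => sub_nonneg.2 (hm l))
        (hacc _ _ hmj) (sub_self _)
      rw [hrec j hj, sub_zero] at this
      exact le_antisymm (this ▸ hm i) (hL0 i)
    simp [hLzero]
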